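/- A universe $\mathbf{U}$ is a Grothendieck universe containing $\omega$. Let $\kappa$ be a (infinite) regular cardinal in a universe $\mathbf{U}$. An object $A$ of a category is $(\kappa,\mathbf{U})$-compact if $\mathrm{Hom}(A,-)$ preserves colimits of all $\mathbf{U}$-small $\kappa$-filtered diagrams; $\mathbf{K}^{\mathbf{U}}_\kappa(\mathcal{C})$ is the full subcategory of $\mathcal{C}$ spanned by these objects. A $\kappa$-accessible $\mathbf{U}$-category is a locally $\mathbf{U}$-small category that has colimits of all $\mathbf{U}$-small $\kappa$-filtered diagrams and a $\mathbf{U}$-small set of $(\kappa,\mathbf{U})$-compact objects such that every object is the colimit of a $\mathbf{U}$-small $\kappa$-filtered diagram of objects of that set; it is a locally $\kappa$-presentable $\mathbf{U}$-category if moreover it has colimits of all $\mathbf{U}$-small diagrams. A functor $F:\mathcal{C}\to\mathcal{D}$ is $(\kappa,\mathbf{U})$-accessible if $\mathcal{C}$ is a $\kappa$-accessible $\mathbf{U}$-category and $F$ preserves colimits of all $\mathbf{U}$-small $\kappa$-filtered diagrams. Let $\mathbf{U}^+\supseteq\mathbf{U}$ be a universe. A $(\kappa,\mathbf{U},\mathbf{U}^+)$-accessible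 extension is a $(\kappa,\mathbf{U})$-accessible functor $i:\mathcal{C}\to\mathcal{C}^+$ such that $\mathcal{C}^+$ is a $\kappa$-accessible $\mathbf{U}^+$-category, $i$ sends $(\kappa,\mathbf{U})$-compact objects to $(\kappa,\mathbf{U}^+)$-compact objects, and the induced functor $\mathbf{K}^{\mathbf{U}}_\kappa(\mathcal{C})\to\mathbf{K}^{\mathbf{U}^+}_\kappa(\mathcal{C}^+)$ is fully faithful and essentially surjective on objects. $\mathbf{Ind}^{\mathbf{U}^+}_\mu(\mathcal{C})$ denotes the free $(\mu,\mathbf{U}^+)$-ind-completion of $\mathcal{C}$, i.e. the category of presheaves on $\mathcal{C}$ that are colimits of representables along $\mathbf{U}^+$-small $\mu$-filtered diagrams in $\mathcal{C}$, and $\gamma:\mathcal{C}\to\mathbf{Ind}^{\mathbf{U}^+}_\mu(\mathcal{C})$ the canonical (Yoneda) embedding. **Theorem.** Let $i:\mathcal{C}\to\mathcal{C}^+$ be a $(\kappa,\mathbf{U},\mathbf{U}^+)$-accessible extension, where $\mathcal{C}$ is a locally $\kappa$-presentable $\mathbf{U}$-category. (i) If $\lambda$ is a regular cardinal in $\mathbf{U}$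 and $\kappa\le\lambda$, then $i$ is also a $(\lambda,\mathbf{U},\mathbf{U}^+)$-accessible extension. Suppose moreover that $\mathbf{U}\in\mathbf{U}^+$, and let $\mu$ be the cardinality of $\mathbf{U}$ (a regular cardinal in $\mathbf{U}^+$). (ii) $i$ sends every object of $\mathcal{C}$ to a $(\mu,\mathbf{U}^+)$-compact object of $\mathcal{C}^+$, and the resulting functor $\mathcal{C}\to\mathbf{K}^{\mathbf{U}^+}_\mu(\mathcal{C}^+)$ is fully faithful and essentially surjective on objects. (iii) There is a $(\mu,\mathbf{U}^+)$-accessible functor $G:\mathbf{Ind}^{\mathbf{U}^+}_\mu(\mathcal{C})\to\mathcal{C}^+$ with $G\circ\gamma\cong i$, and every such functor $G$ is fully faithful and essentially surjective on objects. -/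

import Mathlib

open CategoryTheory CategoryTheory.Limits Opposite

universe w t v₁ v₂ u₁ u₂

namespace UniverseEnlargement

/- A universe `U` is represented by a Lean universe level `w`, its members being (up to bijection)
the types in `Type w`; a universe `U⁺ ⊇ U` is represented by the level `max w t` with `t` arbitrary.
A regular cardinal in `U` is a regular `κ : Cardinal.{w}`; the same cardinal, regarded as a cardinal
in `U⁺`, is `Cardinal.lift.{t} κ : Cardinal.{max w t}`.

In this dictionary (for `κ : Cardinal.{w}`) Mathlib's notions are the following ones:
* `J : Type w` with `[SmallCategory J] [IsCardinalFiltered J κ]`: a `U`-small `κ`-filtered category;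
* `isCardinalPresentable C κ`: the `(κ, U)`-compact objects of `C`, and
  `(isCardinalPresentable C κ).FullSubcategory` is the full subcategory that they span;
* `IsCardinalAccessibleCategory C κ`: `C` is a `κ`-accessible `U`-category
  (this includes that `C` is locally `U`-small);
* `IsCardinalLocallyPresentable C κ`: `C` is a locally `κ`-presentable `U`-category;
* `F.IsCardinalAccessible κ`: `F` preserves colimits of all `U`-small `κ`-filtered diagrams. -/

instance fact_isRegular_lift (κ : Cardinal.{w}) [hκ : Fact κ.IsRegular] :
    Fact (Cardinal.lift.{t} κ).IsRegular :=
  ⟨hκ.out.lift⟩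

/-- `F : C ⥤ D` is a `(κ, U)`-accessible functor: `C` is a `κ`-accessible `U`-category, and `F`
preserves colimits of all `U`-small `κ`-filtered diagrams. -/
structure IsAccessibleFunctor {C : Type u₁} [Category.{v₁} C] {D : Type u₂} [Category.{v₂} D]
    (κ : Cardinal.{w}) [Fact κ.IsRegular] (F : C ⥤ D) : Prop where
  source : IsCardinalAccessibleCategory C κ
  preserves : F.IsCardinalAccessible κ

/-- `i : C ⥤ D` is a `(κ, U, U⁺)`-accessible extension, where `U` is the universe of level `w` and
`U⁺ ⊇ U` is the universe of level `max w t`. -/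
structure IsAccessibleExtension {C : Type u₁} [Category.{v₁} C] {D : Type u₂} [Category.{v₂} D]
    (κ : Cardinal.{w}) [Fact κ.IsRegular] (i : C ⥤ D) : Prop
    extends IsAccessibleFunctor κ i where
  /-- The target is a `κ`-accessible `U⁺`-category. -/
  target : IsCardinalAccessibleCategory D (Cardinal.lift.{t} κ)
  /-- `i` sends `(κ, U)`-compact objects to `(κ, U⁺)`-compact objects. -/
  map_compact : ∀ X : C, isCardinalPresentable C κ X →
    isCardinalPresentable D (Cardinal.lift.{t} κ) (i.obj X)
  /-- The functor induced by `i` between the full subcategories of compact objects is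
  fully faithful and essentially surjective. -/
  isEquivalence_compact :
    ((isCardinalPresentable D (Cardinal.lift.{t} κ)).lift
      ((isCardinalPresentable C κ).ι ⋙ i)
      (fun X ↦ map_compact X.obj X.property)).IsEquivalence

/-- A presheaf on `C` is a `(κ, V)`-ind-object, where `κ` is a regular cardinal in the universe `V`
of level `w`, if it is the colimit of representable presheaves along a `V`-small `κ`-filtered
diagram `F : J ⥤ C`. -/
def isIndObject (C : Type u₁) [Category.{v₁} C] (κ : Cardinal.{w}) [Fact κ.IsRegular] :
    ObjectProperty (Cᵒᵖ ⥤ Type (max w v₁)) := fun P ↦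
  ∃ (J : Type w) (_ : SmallCategory J) (_ : IsCardinalFiltered J κ) (F : J ⥤ C)
    (ι : F ⋙ uliftYoneda.{w} ⟶ (Functor.const J).obj P),
    Nonempty (IsColimit (Cocone.mk P ι))

/-- The free `(κ, V)`-ind-completion of `C`. -/
abbrev IndCompletion (C : Type u₁) [Category.{v₁} C] (κ : Cardinal.{w}) [Fact κ.IsRegular] :
    Type _ :=
  (isIndObject C κ).FullSubcategory

/-- Representable presheaves are colimits of one-point diagrams. -/
theorem isIndObject_uliftYoneda_obj (C : Type u₁) [Category.{v₁} C] (κ : Cardinal.{w})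
    [Fact κ.IsRegular] (X : C) : isIndObject C κ (uliftYoneda.{w}.obj X) :=
  ⟨Discrete PUnit.{w + 1}, inferInstance,
    ⟨fun {_} _ _ _ ↦ ⟨{ pt := ⟨PUnit.unit⟩
                        ι := { app := fun _ ↦ eqToHom (Subsingleton.elim _ _) } }⟩⟩,
    Functor.fromPUnit X, { app := fun _ ↦ 𝟙 _ },
    ⟨{ desc := fun s ↦ s.ι.app ⟨PUnit.unit⟩
       uniq := fun s m h ↦ by simpa using h ⟨PUnit.unit⟩ }⟩⟩

/-- The canonical embedding of `C` in its free `(κ, V)`-ind-completion. -/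
def indEmbedding (C : Type u₁) [Category.{v₁} C] (κ : Cardinal.{w}) [Fact κ.IsRegular] :
    C ⥤ IndCompletion C κ :=
  (isIndObject C κ).lift uliftYoneda.{w} (isIndObject_uliftYoneda_obj C κ)

/-- `G` is a `(κ, V)`-accessible functor on the free `(κ, V)`-ind-completion of `C` that is induced
by `F : C ⥤ D`, i.e. whose restriction along the canonical embedding is `F`, up to isomorphism. -/
structure IsIndExtension {C : Type u₁} [Category.{v₁} C] {D : Type u₂} [Category.{v₂} D]
    (κ : Cardinal.{w}) [Fact κ.IsRegular] (F : C ⥤ D) (G : IndCompletion C κ ⥤ D) : Prop where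
  accessible : IsAccessibleFunctor κ G
  restrict : Nonempty (indEmbedding C κ ⋙ G ≅ F)

end UniverseEnlargement

/-!
Why the theorem is true. Everything is controlled by the compact objects of index `κ`, which are
the same in `C` and in `D`.

*Full faithfulness.* A morphism from a compact object to a `κ`-filtered colimit of compact objects
factors through a stage, both in `C` and in `D`; so `i` is fully faithful because it is so on
compact objects (`IsAccessibleExtension.full_and_faithful`).

*Cocontinuity.* The extension preserves all `U`-small colimits
(`IsAccessibleExtension.preservesColimitsOfSize`), and `D` has all `U⁺`-small colimits
(`IsAccessibleExtension.hasColimitsOfSize`), by the same three steps. For a `κ`-small diagram of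
compact objects of `C`, the colimit in `C` remains a colimit in `D`, because any object of `D` is
the `κ`-filtered colimit of the compact objects over it and these come from `C`. For an arbitrary
small diagram of compact objects, the colimits of its restrictions to the `κ`-small subgraphs of the
index category form a `κ`-filtered diagram, the colimit of which is the colimit of the whole diagram
(`exists_isColimit_of_isPartialColimit`). Finally the compact objects are dense, so that the colimit
of any diagram `F` is the colimit of the diagram of all compact objects over objects of `F`
(`exists_isColimit_of_comma`). In particular `D` is locally presentable.

*Compact objects of higher index.* In a locally `κ`-presentable category, the compact objects of
index `l ≥ κ` form the closure under `l`-small colimits of those of index `κ`. When `l` is in `U`,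
or when `l` is the cardinality `m` of `U`, the `l`-small categories are essentially `U`-small, so
the essential image of `i` is closed under `l`-small colimits and contains all the compact objects
of `D` of index `l` (`IsAccessibleExtension.isCardinalPresentable_le_essImage`). Conversely `i`
sends the compact objects of index `l` in `U` to compact ones, and every object to a compact one of
index `m`, as every object of `C` is a `U`-small, hence `m`-small, colimit of compact objects of
index `κ`.

*Ind-completion.* Thus `C` is equivalent to the category of compact objects of index `m` of `D`,
which is accessible of index `m`; the restricted Yoneda functor of `i` is then an equivalence from
`D` to the ind-completion of `C` (`exists_equivalence_indCompletion`), and its inverse extends `i`.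
Any accessible functor on the ind-completion that extends `i` is an equivalence: it is fully
faithful on representables, which are compact and are sent to compact objects, and every object of
`D` is a filtered colimit of objects in the image of `i`
(`isEquivalence_of_isIndExtension`).
-/

universe v₃ v₄ u₃ u₄

namespace UniverseEnlargement

/-! ### Colimits of arbitrary diagrams from colimits of diagrams in a dense subcategory -/

section Comma

variable {C : Type u₁} [Category.{v₁} C] {D : Type u₂} [Category.{v₂} D]
  {J : Type u₃} [Category.{v₃} J] {A : Type u₄} [Category.{v₄} A] (K : A ⥤ C) (i : C ⥤ D)

/-- The canonical cocone with point `X` over the diagram of all the objects `K.obj a` over `X`. -/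
def canonicalCocone (X : C) : Cocone (CostructuredArrow.proj K X ⋙ K) where
  pt := X
  ι :=
    { app := fun g ↦ g.hom
      naturality := fun _ _ f ↦ (CostructuredArrow.w f).trans (Category.comp_id _).symm }

/-- The canonical cocones are colimiting when `K` is dense. -/
noncomputable def isColimitCanonicalCocone [K.IsDense] (X : C) :
    IsColimit (canonicalCocone K X) :=
  (K.denseAt X).ofIsoColimit (Cocone.ext (Iso.refl X) (fun j ↦
    (Category.comp_id _).trans (Category.id_comp j.hom)))

variable {K i} {F : J ⥤ C}

/-- A cocone over `F ⋙ i` restricts to a cocone over the diagram indexed by all the morphisms from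
an object `K.obj a` to an object of the diagram `F`. -/
def commaCocone (c : Cocone (F ⋙ i)) : Cocone (Comma.fst K F ⋙ K ⋙ i) where
  pt := c.pt
  ι :=
    { app := fun f ↦ i.map f.hom ≫ c.ι.app f.right
      naturality := fun f g φ ↦ by
        have h₁ : i.map (F.map φ.right) ≫ c.ι.app g.right = c.ι.app f.right := c.w φ.right
        have h₂ : i.map (K.map φ.left) ≫ i.map g.hom = i.map f.hom ≫ i.map (F.map φ.right) := by
          rw [← i.map_comp, ← i.map_comp, φ.w]
        have h₃ : i.map (K.map φ.left) ≫ i.map g.hom ≫ c.ι.app g.right =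
            i.map f.hom ≫ c.ι.app f.right := by
          rw [reassoc_of% h₂, h₁]
        exact h₃.trans (Category.comp_id _).symm }

variable (h : ∀ j, Nonempty (IsColimit (i.mapCocone (canonicalCocone K (F.obj j)))))

include h

/-- Morphisms out of `i.obj (F.obj j)` are detected by the objects `K.obj a` over `F.obj j`. -/
lemma hom_ext_of_canonicalCocone {j : J} {X : D} {f g : i.obj (F.obj j) ⟶ X}
    (hfg : ∀ (a : A) (x : K.obj a ⟶ F.obj j), i.map x ≫ f = i.map x ≫ g) : f = g :=
  (h j).some.hom_ext fun x ↦ hfg x.left x.hom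

/-- The restriction of cocones is surjective: the components of a cocone at the arrows to `F.obj j`
glue to a morphism out of `i.obj (F.obj j)`. -/
lemma exists_commaCocone (s : Cocone (Comma.fst K F ⋙ K ⋙ i)) :
    ∃ (φ : F ⋙ i ⟶ (Functor.const J).obj s.pt),
      commaCocone (K := K) (Cocone.mk s.pt φ) = s := by
  have key (j : J) : ∃ φ : i.obj (F.obj j) ⟶ s.pt, ∀ (a : A) (x : K.obj a ⟶ F.obj j),
      i.map x ≫ φ = s.ι.app (Comma.mk a j x) := by
    let S : Cocone ((CostructuredArrow.proj K (F.obj j) ⋙ K) ⋙ i) :=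
      { pt := s.pt
        ι :=
          { app := fun g ↦ s.ι.app (Comma.mk g.left j g.hom)
            naturality := fun g g' φ ↦ by
              let ψ : (Comma.mk g.left j g.hom : Comma K F) ⟶ Comma.mk g'.left j g'.hom :=
                { left := φ.left
                  right := 𝟙 j
                  w := by simp }
              exact (s.w ψ).trans (Category.comp_id _).symm } }
    exact ⟨(h j).some.desc S, fun a x ↦ (h j).some.fac S (CostructuredArrow.mk x)⟩
  choose φ hφ using key
  have hnat {j j' : J} (u : j ⟶ j') : i.map (F.map u) ≫ φ j' = φ j := by
    refine hom_ext_of_canonicalCocone h fun a x ↦ ?_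
    let ψ : (Comma.mk a j x : Comma K F) ⟶ Comma.mk a j' (x ≫ F.map u) :=
      { left := 𝟙 _, right := u }
    have h₃ : i.map (K.map (𝟙 a)) ≫ s.ι.app (Comma.mk a j' (x ≫ F.map u)) =
      s.ι.app (Comma.mk a j x) := s.w ψ
    rw [← i.map_comp_assoc, hφ, hφ, ← h₃, K.map_id, i.map_id]
    exact (Category.id_comp _).symm
  refine ⟨{ app := φ, naturality := fun j j' u ↦ (hnat u).trans (Category.comp_id _).symm }, ?_⟩
  obtain ⟨X, α⟩ := s
  refine congrArg (Cocone.mk X) ?_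
  ext f
  exact hφ f.right f.left f.hom

/-- Since each object of the diagram `F` is the canonical colimit of objects `K.obj a`, a cocone
is colimiting as soon as its restriction to these objects is. -/
noncomputable def isColimitOfCommaCocone (c : Cocone (F ⋙ i))
    (hc : IsColimit (commaCocone (K := K) c)) : IsColimit c where
  desc s := hc.desc (commaCocone s)
  fac s j := hom_ext_of_canonicalCocone h fun a x ↦
    (Category.assoc _ _ _).symm.trans (hc.fac (commaCocone s) (Comma.mk a j x))
  uniq s m hm := hc.uniq (commaCocone s) m fun f ↦
    (Category.assoc _ _ _).trans (congrArg (i.map f.hom ≫ ·) (hm f.right))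

lemma exists_isColimit_of_comma {s : Cocone (Comma.fst K F ⋙ K ⋙ i)} (hs : IsColimit s) :
    ∃ (c : Cocone (F ⋙ i)), commaCocone (K := K) c = s ∧ Nonempty (IsColimit c) := by
  obtain ⟨φ, hφ⟩ := exists_commaCocone h s
  rw [← hφ] at hs
  exact ⟨_, hφ, ⟨isColimitOfCommaCocone h _ hs⟩⟩

end Comma

lemma essentiallySmall_comma {C : Type u₁} [Category.{v₁} C] [LocallySmall.{w} C]
    {A : Type u₂} [Category.{v₂} A] [EssentiallySmall.{w} A] (K : A ⥤ C)
    {J : Type w} [SmallCategory J] (F : J ⥤ C) : EssentiallySmall.{w} (Comma K F) := by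
  let e := (equivSmallModel.{w} A).inverse
  rw [← essentiallySmall_congr (Comma.preLeft e K F).asEquivalence]
  have : Small.{w} (Comma (e ⋙ K) F) :=
    small_of_surjective (f := fun (f : Σ (X : SmallModel.{w} A) (j : J),
      (e ⋙ K).obj X ⟶ F.obj j) ↦ Comma.mk f.1 f.2.1 f.2.2)
      (fun f ↦ ⟨⟨f.left, f.right, f.hom⟩, rfl⟩)
  have : LocallySmall.{w} (Comma (e ⋙ K) F) :=
    ⟨fun X Y ↦ small_of_injective (f := fun (g : X ⟶ Y) ↦ (g.left, g.right)) (fun g g' hg ↦ by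
      simp only [Prod.mk.injEq] at hg
      exact CommaMorphism.ext hg.1 hg.2)⟩
  exact essentiallySmall_of_small_of_locallySmall _

/-! ### Colimits of small diagrams from `κ`-small and `κ`-filtered colimits -/

section Partial

variable {C : Type u₁} [Category.{v₁} C] {D : Type u₂} [Category.{v₂} D]
  {E : Type u₃} [Category.{v₃} E]

/-- If `Z` is a set of objects and arrows of `E`, the condition that a family of morphisms
`G.obj e ⟶ X`, for the objects `e` in `Z`, is compatible with the arrows in `Z`
(those with both endpoints in `Z`). -/
def IsPartialCocone (G : E ⥤ C) (Z : Set (E ⊕ Arrow E)) {X : C}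
    (x : ∀ e, Sum.inl e ∈ Z → (G.obj e ⟶ X)) : Prop :=
  ∀ ⦃a b : E⦄ (f : a ⟶ b) (ha : Sum.inl a ∈ Z) (hb : Sum.inl b ∈ Z),
    Sum.inr (Arrow.mk f) ∈ Z → G.map f ≫ x b hb = x a ha

/-- If `Z` is a set of objects and arrows of `E`, the condition that `X` is the colimit of the
restriction of the diagram `G` to the subgraph of `E` given by `Z`. -/
structure IsPartialColimit (G : E ⥤ C) (Z : Set (E ⊕ Arrow E)) {X : C}
    (x : ∀ e, Sum.inl e ∈ Z → (G.obj e ⟶ X)) : Prop where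
  isPartialCocone : IsPartialCocone G Z x
  hom_ext {Y : C} {f g : X ⟶ Y} : (∀ e he, x e he ≫ f = x e he ≫ g) → f = g
  exists_desc {Y : C} (y : ∀ e, Sum.inl e ∈ Z → (G.obj e ⟶ Y)) :
    IsPartialCocone G Z y → ∃ f : X ⟶ Y, ∀ e he, x e he ≫ f = y e he

/-- The shape of the multicoequalizers which compute the colimits over the subgraph given by `Z`:
its left part consists of the arrows in `Z` with both endpoints in `Z`, its right part of the
objects in `Z`. -/
def partialShape (Z : Set (E ⊕ Arrow E)) : MultispanShape where
  L := { f : Arrow E // Sum.inr f ∈ Z ∧ Sum.inl f.left ∈ Z ∧ Sum.inl f.right ∈ Z }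
  R := { e : E // Sum.inl e ∈ Z }
  fst f := ⟨f.1.left, f.2.2.1⟩
  snd f := ⟨f.1.right, f.2.2.2⟩

/-- The pairs of morphisms `𝟙` and `G.map f`, for the arrows `f` of the subgraph given by `Z`: their
multicoequalizer is the colimit of the restriction of `G` to this subgraph. -/
def partialIndex (G : E ⥤ C) (Z : Set (E ⊕ Arrow E)) : MultispanIndex (partialShape Z) C where
  left f := G.obj f.1.left
  right e := G.obj e.1
  fst f := 𝟙 (G.obj f.1.left)
  snd f := G.map f.1.hom

lemma hasCardinalLT_arrow_walkingMultispan {S : MultispanShape.{u₁, u₂}} {κ : Cardinal.{w}}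
    (hκ : Cardinal.aleph0 ≤ κ) (hL : HasCardinalLT S.L κ) (hR : HasCardinalLT S.R κ) :
    HasCardinalLT (Arrow (WalkingMultispan S)) κ := by
  have : HasCardinalLT ((S.L ⊕ S.R) ⊕ (S.L ⊕ S.L)) κ := by
    simp only [hasCardinalLT_sum_iff _ _ _ hκ]
    tauto
  refine this.of_surjective (Sum.elim
    (Sum.elim (fun a ↦ Arrow.mk (𝟙 (WalkingMultispan.left a)))
      (fun b ↦ Arrow.mk (𝟙 (WalkingMultispan.right b))))
    (Sum.elim (fun a ↦ Arrow.mk (WalkingMultispan.Hom.fst a :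
        WalkingMultispan.left a ⟶ WalkingMultispan.right _))
      (fun a ↦ Arrow.mk (WalkingMultispan.Hom.snd a :
        WalkingMultispan.left a ⟶ WalkingMultispan.right _)))) ?_
  rintro ⟨X, Y, f⟩
  change WalkingMultispan.Hom X Y at f
  cases f with
  | id =>
    cases X with
    | left a => exact ⟨Sum.inl (Sum.inl a), rfl⟩
    | right b => exact ⟨Sum.inl (Sum.inr b), rfl⟩
  | fst a => exact ⟨Sum.inr (Sum.inl a), rfl⟩
  | snd a => exact ⟨Sum.inr (Sum.inr a), rfl⟩

lemma hasCardinalLT_arrow_partialShape {κ : Cardinal.{w}} (hκ : Cardinal.aleph0 ≤ κ)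
    {Z : Set (E ⊕ Arrow E)} (hZ : HasCardinalLT Z κ) :
    HasCardinalLT (Arrow (WalkingMultispan (partialShape Z))) κ :=
  hasCardinalLT_arrow_walkingMultispan hκ
    (hZ.of_injective (fun f ↦ ⟨Sum.inr f.1, f.2.1⟩) (fun f g h ↦ Subtype.ext (by simpa using h)))
    (hZ.of_injective (fun e ↦ ⟨Sum.inl e.1, e.2⟩) (fun f g h ↦ Subtype.ext (by simpa using h)))

/-- If a functor preserves the multicoequalizer that computes the colimit over a subgraph, then the
image is the colimit over this subgraph of the image diagram. -/
lemma isPartialColimit_map (i : C ⥤ D) {G : E ⥤ C} {Z : Set (E ⊕ Arrow E)}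
    {c : Cocone (partialIndex G Z).multispan} (hc : IsColimit (i.mapCocone c)) :
    IsPartialColimit (G ⋙ i) Z
      (fun e he ↦ i.map (c.ι.app (WalkingMultispan.right ⟨e, he⟩) : G.obj e ⟶ c.pt)) where
  isPartialCocone a b f ha hb hf := by
    let l : (partialShape Z).L := ⟨Arrow.mk f, hf, ha, hb⟩
    have h₁ : 𝟙 (G.obj a) ≫ c.ι.app (WalkingMultispan.right ⟨a, ha⟩) =
      c.ι.app (WalkingMultispan.left l) := c.w (WalkingMultispan.Hom.fst l)
    have h₂ : G.map f ≫ c.ι.app (WalkingMultispan.right ⟨b, hb⟩) =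
      c.ι.app (WalkingMultispan.left l) := c.w (WalkingMultispan.Hom.snd l)
    exact (i.map_comp _ _).symm.trans
      (congrArg i.map (h₂.trans (h₁.symm.trans (Category.id_comp _))))
  hom_ext {Y f g} hfg := by
    have hR (e : (partialShape Z).R) : (i.mapCocone c).ι.app (WalkingMultispan.right e) ≫ f =
        (i.mapCocone c).ι.app (WalkingMultispan.right e) ≫ g := hfg e.1 e.2
    refine hc.hom_ext fun j ↦ ?_
    cases j with
    | left l =>
      rw [← (i.mapCocone c).w (WalkingMultispan.Hom.fst l), Category.assoc, Category.assoc, hR]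
    | right e => exact hR e
  exists_desc {Y} y hy := by
    let s : Cocone ((partialIndex G Z).multispan ⋙ i) :=
      { pt := Y
        ι :=
          { app := fun j ↦ match j with
              | .left l => y l.1.left l.2.2.1
              | .right e => y e.1 e.2
            naturality := by
              rintro _ _ (_ | l | l)
              · exact (congrArg (· ≫ _) (CategoryTheory.Functor.map_id _ _)).trans
                  ((Category.id_comp _).trans (Category.comp_id _).symm)
              · exact (congrArg (· ≫ _) (i.map_id _)).trans
                  ((Category.id_comp _).trans (Category.comp_id _).symm)
              · exact (hy l.1.hom l.2.2.1 l.2.2.2 l.2.1).trans (Category.comp_id _).symm } }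
    exact ⟨hc.desc s, fun e he ↦ hc.fac s (WalkingMultispan.right ⟨e, he⟩)⟩

end Partial

section Filtered

variable {C : Type u₁} [Category.{v₁} C] {D : Type u₂} [Category.{v₂} D]
  {E : Type w} [SmallCategory E] {κ : Cardinal.{w}} {G : E ⥤ C}

/-- The colimits of the restrictions of a diagram `G` to the `κ`-small subgraphs of the
index category form a functor. -/
noncomputable def partialFunctor {X : HasCardinalLT.Set (E ⊕ Arrow E) κ → C}
    {x : ∀ Z e, Sum.inl e ∈ Z.1 → (G.obj e ⟶ X Z)} (hx : ∀ Z, IsPartialColimit G Z.1 (x Z)) :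
    HasCardinalLT.Set (E ⊕ Arrow E) κ ⥤ C :=
  have hmap (Z Z' : HasCardinalLT.Set (E ⊕ Arrow E) κ) (u : Z ⟶ Z') :=
    (hx Z).exists_desc (fun e he ↦ x Z' e (leOfHom u he))
      (fun a b f ha hb hf ↦ (hx Z').isPartialCocone f _ _ (leOfHom u hf))
  { obj := X
    map := fun u ↦ (hmap _ _ u).choose
    map_id := fun Z ↦ (hx Z).hom_ext (fun e he ↦ by
      rw [(hmap _ _ (𝟙 Z)).choose_spec, Category.comp_id])
    map_comp := fun u v ↦ (hx _).hom_ext (fun e he ↦ by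
      rw [(hmap _ _ (u ≫ v)).choose_spec, ← Category.assoc, (hmap _ _ u).choose_spec,
        (hmap _ _ v).choose_spec]) }

lemma partialFunctor_map {X : HasCardinalLT.Set (E ⊕ Arrow E) κ → C}
    {x : ∀ Z e, Sum.inl e ∈ Z.1 → (G.obj e ⟶ X Z)} (hx : ∀ Z, IsPartialColimit G Z.1 (x Z))
    {Z Z' : HasCardinalLT.Set (E ⊕ Arrow E) κ} (u : Z ⟶ Z') (e : E) (he : Sum.inl e ∈ Z.1) :
    x Z e he ≫ (partialFunctor hx).map u = x Z' e (leOfHom u he) :=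
  ((hx Z).exists_desc (fun e he ↦ x Z' e (leOfHom u he))
      (fun _ _ f _ _ hf ↦ (hx Z').isPartialCocone f _ _ (leOfHom u hf))).choose_spec e he

/-- The colimit of a small diagram is the `κ`-filtered colimit of the colimits of its restrictions
to the `κ`-small subgraphs of the index category. -/
lemma exists_isColimit_of_isPartialColimit [Fact κ.IsRegular]
    {Q : HasCardinalLT.Set (E ⊕ Arrow E) κ ⥤ C}
    {q : ∀ Z e, Sum.inl e ∈ Z.1 → (G.obj e ⟶ Q.obj Z)}
    (hq : ∀ Z, IsPartialColimit G Z.1 (q Z))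
    (hQ : ∀ ⦃Z Z'⦄ (u : Z ⟶ Z') (e : E) (he : Sum.inl e ∈ Z.1),
        q Z e he ≫ Q.map u = q Z' e (leOfHom u he))
    {c : Cocone Q} (hc : IsColimit c) :
    ∃ φ : G ⟶ (Functor.const E).obj c.pt, Nonempty (IsColimit (Cocone.mk c.pt φ)) ∧
      ∀ Z e he, φ.app e = q Z e he ≫ c.ι.app Z := by
  have hκ : Cardinal.aleph0 ≤ κ := Cardinal.IsRegular.aleph0_le Fact.out
  let one (e : E) : HasCardinalLT.Set (E ⊕ Arrow E) κ :=
    ⟨{Sum.inl e}, hasCardinalLT_of_finite _ _ hκ⟩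
  let x (e : E) : G.obj e ⟶ c.pt := q (one e) e rfl ≫ c.ι.app (one e)
  have hx (Z) (e : E) (he : Sum.inl e ∈ Z.1) : x e = q Z e he ≫ c.ι.app Z := by
    let u : one e ⟶ Z := homOfLE (Set.singleton_subset_iff.2 he)
    rw [← hQ u e rfl, Category.assoc, c.w u]
  have hnat {a b : E} (f : a ⟶ b) : G.map f ≫ x b = x a := by
    let Z : HasCardinalLT.Set (E ⊕ Arrow E) κ :=
      ⟨{Sum.inl a, Sum.inl b, Sum.inr (Arrow.mk f)}, hasCardinalLT_of_finite _ _ hκ⟩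
    have ha : Sum.inl a ∈ Z.1 := by simp [Z]
    have hb : Sum.inl b ∈ Z.1 := by simp [Z]
    have hf : Sum.inr (Arrow.mk f) ∈ Z.1 := by simp [Z]
    rw [hx Z a ha, hx Z b hb, ← Category.assoc, (hq Z).isPartialCocone f ha hb hf]
  let φ : G ⟶ (Functor.const E).obj c.pt :=
    { app := x, naturality := fun a b f ↦ (hnat f).trans (Category.comp_id _).symm }
  refine ⟨φ, ⟨?_⟩, hx⟩
  -- A cocone over `G` induces compatible morphisms out of the partial colimits.
  have key (s : Cocone G) : ∃ m : c.pt ⟶ s.pt, ∀ e, x e ≫ m = s.ι.app e := by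
    have hs (Z : HasCardinalLT.Set (E ⊕ Arrow E) κ) :=
      (hq Z).exists_desc (fun e _ ↦ s.ι.app e) (fun a b f _ _ _ ↦ s.w f)
    choose m hm using hs
    let S : Cocone Q :=
      { pt := s.pt
        ι :=
          { app := m
            naturality := fun Z Z' u ↦ (hq Z).hom_ext (fun e he ↦ by
              rw [← Category.assoc, hQ, hm]
              exact (hm Z e he).symm.trans (congrArg _ (Category.comp_id _).symm)) } }
    refine ⟨hc.desc S, fun e ↦ ?_⟩
    rw [Category.assoc, hc.fac]
    exact hm _ _ _
  exact
    { desc := fun s ↦ (key s).choose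
      fac := fun s ↦ (key s).choose_spec
      uniq := fun s m hm ↦ hc.hom_ext fun Z ↦ (hq Z).hom_ext fun e he ↦ by
        rw [← Category.assoc, ← hx, ← Category.assoc, ← hx, (key s).choose_spec]
        exact hm e }

end Filtered

/-! ### Full faithfulness can be checked on generators -/

/-- A functor that preserves presentations of all objects as filtered colimits of generators is
fully faithful if it is so on generators, provided that homming out of the generators, and out of
their images, commutes with these colimits. -/
lemma full_and_faithful_of_presentations {A : Type u₁} [Category.{v₁} A]
    {B : Type u₂} [Category.{v₂} B] (F : A ⥤ B) (P : ObjectProperty A)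
    (hP : ∀ X Y, P X → P Y → Function.Bijective (F.map : (X ⟶ Y) → (F.obj X ⟶ F.obj Y)))
    (H : ∀ X : A, ∃ (J : Type w) (_ : SmallCategory J) (_ : IsFiltered J)
      (p : P.ColimitOfShape J X), PreservesColimit p.diag F ∧
        ∀ Z, P Z → PreservesColimit p.diag (coyoneda.obj (op Z)) ∧
          PreservesColimit (p.diag ⋙ F) (coyoneda.obj (op (F.obj Z)))) :
    F.Full ∧ F.Faithful := by
  have h₁ (Z X : A) (hZ : P Z) :
      Function.Bijective (F.map : (Z ⟶ X) → (F.obj Z ⟶ F.obj X)) := by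
    obtain ⟨J, _, _, p, _, hp⟩ := H X
    obtain ⟨_, _⟩ := hp Z hZ
    let hF := isColimitOfPreserves F p.isColimit
    constructor
    · intro f g hfg
      obtain ⟨j, f', rfl⟩ := exists_hom_of_preservesColimit_coyoneda p.isColimit f
      obtain ⟨j', g', rfl⟩ := exists_hom_of_preservesColimit_coyoneda p.isColimit g
      obtain ⟨k, u, v, huv⟩ := exists_eq_of_preservesColimit_coyoneda hF (F.map f') (F.map g')
        (by simpa using! hfg)
      have : f' ≫ p.diag.map u = g' ≫ p.diag.map v :=
        (hP _ _ hZ (p.prop_diag_obj k)).1 (by simpa using! huv)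
      rw [← p.cocone.w u, ← p.cocone.w v, reassoc_of% this]
    · intro f
      obtain ⟨j, f', rfl⟩ := exists_hom_of_preservesColimit_coyoneda hF f
      obtain ⟨g, rfl⟩ := (hP _ _ hZ (p.prop_diag_obj j)).2 f'
      exact ⟨g ≫ p.ι.app j, F.map_comp _ _⟩
  refine ⟨⟨fun {X Y} f ↦ ?_⟩, ⟨fun {X Y} f g hfg ↦ ?_⟩⟩
  · obtain ⟨J, _, _, p, _, hp⟩ := H X
    let hF := isColimitOfPreserves F p.isColimit
    choose y hy using fun j ↦ (h₁ _ Y (p.prop_diag_obj j)).2 (F.map (p.ι.app j) ≫ f)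
    let s : Cocone p.diag :=
      { pt := Y
        ι :=
          { app := y
            naturality := fun j j' u ↦ (h₁ _ Y (p.prop_diag_obj j)).1 (by
              have h : p.diag.map u ≫ p.ι.app j' = p.ι.app j := p.cocone.w u
              rw [F.map_comp, hy, ← F.map_comp_assoc, h, ← hy]
              exact congrArg F.map (Category.comp_id _).symm) } }
    refine ⟨p.isColimit.desc s, hF.hom_ext fun j ↦ ?_⟩
    have : p.ι.app j ≫ p.isColimit.desc s = y j := p.isColimit.fac s j
    exact (F.map_comp _ _).symm.trans ((congrArg F.map this).trans (hy j))
  · obtain ⟨J, _, _, p, -⟩ := H X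
    exact p.isColimit.hom_ext fun j ↦ (h₁ _ Y (p.prop_diag_obj j)).1 (by
      rw [F.map_comp, F.map_comp, hfg])

/-! ### Smallness and the cardinality of a universe -/

lemma isCardinalFiltered_lift (κ : Cardinal.{w}) [Fact κ.IsRegular] (J : Type u₁) [Category.{v₁} J]
    [IsCardinalFiltered J κ] : IsCardinalFiltered J (Cardinal.lift.{t} κ) where
  nonempty_cocone F hA := ⟨IsCardinalFiltered.cocone (κ := κ) F (by simpa using hA)⟩

lemma essentiallySmall_of_small_arrow (J : Type u₁) [Category.{v₁} J] [Small.{w} (Arrow J)] :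
    EssentiallySmall.{w} J := by
  have := small_of_small_arrow.{w} J
  have := locallySmall_of_small_arrow.{w} J
  exact essentiallySmall_of_small_of_locallySmall _

lemma hasColimitsOfShape_of_hasColimitsOfSize {C : Type u₁} [Category.{v₁} C]
    [HasColimitsOfSize.{w, w} C] (J : Type u₂) [Category.{v₂} J] [EssentiallySmall.{w} J] :
    HasColimitsOfShape J C :=
  hasColimitsOfShape_of_equivalence (equivSmallModel.{w} J).symm

section

variable {m : Cardinal.{max w t}} (hm : Cardinal.lift.{w + 1} m = Cardinal.univ.{w, t})

include hm

lemma isRegular_of_lift_eq_univ : m.IsRegular := by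
  have h : Cardinal.univ.{w, t}.IsRegular := Cardinal.IsInaccessible.univ.isRegular
  rw [← hm] at h
  exact Cardinal.isRegular_lift_iff.1 h

/-- The types of cardinality less than the cardinality `m` of the smaller universe are the types
which are small with respect to this universe. -/
lemma hasCardinalLT_iff_small_of_lift_eq_univ (X : Type u₁) :
    HasCardinalLT X m ↔ Small.{w} X := by
  have h : Cardinal.lift.{w + 1} (Cardinal.lift.{u₁} m) = Cardinal.univ.{w, max t u₁} := by
    have h' := congrArg Cardinal.lift.{u₁} hm
    rw [Cardinal.lift_univ] at h'
    rw [← h', Cardinal.lift_lift, Cardinal.lift_lift]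
  have h₁ : HasCardinalLT X m ↔
      Cardinal.lift.{max t (w + 1)} (Cardinal.mk X) < Cardinal.univ.{w, max t u₁} := by
    rw [HasCardinalLT, ← Cardinal.lift_lt.{_, w + 1}, h, Cardinal.lift_lift]
  have h₂ : Small.{w} X ↔
      Cardinal.lift.{max t (w + 1)} (Cardinal.mk X) < Cardinal.univ.{w, max t u₁} := by
    rw [Cardinal.small_iff_lift_mk_lt_univ, ← Cardinal.lift_lt.{_, t}, Cardinal.lift_univ,
      Cardinal.lift_lift]
    exact Iff.of_eq (congrArg _ (Cardinal.univ_umax.{w, max t u₁}))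
  exact h₁.trans h₂.symm

lemma lift_le_of_lift_eq_univ (κ : Cardinal.{w}) : Cardinal.lift.{t} κ ≤ m := by
  rw [← Cardinal.lift_le.{w + 1}, hm, Cardinal.lift_lift]
  exact (Cardinal.lift_lt_univ' κ).le

end

/-! ### Accessible extensions: full faithfulness and colimits of compact objects -/

/-- The compact objects over `X` form a `κ`-filtered category, whose colimit is preserved by
accessible functors. -/
lemma isColimit_mapCocone_canonicalCocone {C : Type u₁} [Category.{v₁} C]
    {D : Type u₂} [Category.{v₂} D] (κ : Cardinal.{w}) [Fact κ.IsRegular]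
    [IsCardinalAccessibleCategory C κ] (F : C ⥤ D) [F.IsCardinalAccessible κ] (X : C) :
    Nonempty (IsColimit (F.mapCocone (canonicalCocone (isCardinalPresentable C κ).ι X))) := by
  have := F.preservesColimitsOfShape_of_isCardinalAccessible_of_essentiallySmall κ
    (CostructuredArrow (isCardinalPresentable C κ).ι X)
  exact ⟨isColimitOfPreserves F (isColimitCanonicalCocone _ X)⟩

/-- A diagram of objects in the image of a fully faithful functor lifts along this functor. -/
lemma exists_comp_iso {C : Type u₁} [Category.{v₁} C] {D : Type u₂} [Category.{v₂} D]
    (i : C ⥤ D) [i.Full] [i.Faithful] (P : ObjectProperty C) {J : Type u₃} [Category.{v₃} J]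
    (M : J ⥤ D) (hM : ∀ j, ∃ X, P X ∧ Nonempty (i.obj X ≅ M.obj j)) :
    ∃ F : J ⥤ C, (∀ j, P (F.obj j)) ∧ Nonempty (F ⋙ i ≅ M) := by
  choose N hN e using hM
  let F : J ⥤ C :=
    { obj := N
      map := fun {j j'} u ↦ i.preimage ((e j).some.hom ≫ M.map u ≫ (e j').some.inv)
      map_id := fun j ↦ i.map_injective (by simp)
      map_comp := fun u v ↦ i.map_injective (by simp) }
  exact ⟨F, hN, ⟨NatIso.ofComponents (fun j ↦ (e j).some) (fun u ↦ by simp [F])⟩⟩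

namespace IsAccessibleExtension

variable {C : Type u₁} [Category.{v₁} C] {D : Type u₂} [Category.{v₂} D]
  {κ : Cardinal.{w}} [Fact κ.IsRegular] {i : C ⥤ D} (hi : IsAccessibleExtension.{w, t} κ i)

include hi

lemma bijective_map_of_compact {X Y : C} (hX : isCardinalPresentable C κ X)
    (hY : isCardinalPresentable C κ Y) :
    Function.Bijective (i.map : (X ⟶ Y) → (i.obj X ⟶ i.obj Y)) := by
  have := hi.isEquivalence_compact
  let G := (isCardinalPresentable D (Cardinal.lift.{t} κ)).lift
      ((isCardinalPresentable C κ).ι ⋙ i) (fun X ↦ hi.map_compact X.obj X.property)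
  let X' : (isCardinalPresentable C κ).FullSubcategory := ⟨X, hX⟩
  let Y' : (isCardinalPresentable C κ).FullSubcategory := ⟨Y, hY⟩
  refine ⟨fun f g h ↦ ?_, fun f ↦ ?_⟩
  · have : G.map (ObjectProperty.homMk f : X' ⟶ Y') = G.map (ObjectProperty.homMk g) := by
      ext
      exact h
    exact congrArg (fun φ ↦ φ.hom) (G.map_injective this)
  · obtain ⟨g, hg⟩ := G.map_surjective (ObjectProperty.homMk f : G.obj X' ⟶ G.obj Y')
    exact ⟨g.hom, congrArg (fun φ ↦ φ.hom) hg⟩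

lemma exists_iso_of_compact {Y : D} (hY : isCardinalPresentable D (Cardinal.lift.{t} κ) Y) :
    ∃ X : C, isCardinalPresentable C κ X ∧ Nonempty (i.obj X ≅ Y) := by
  have := hi.isEquivalence_compact
  let G := (isCardinalPresentable D (Cardinal.lift.{t} κ)).lift
      ((isCardinalPresentable C κ).ι ⋙ i) (fun X ↦ hi.map_compact X.obj X.property)
  let Y' : (isCardinalPresentable D (Cardinal.lift.{t} κ)).FullSubcategory := ⟨Y, hY⟩
  exact ⟨(G.objPreimage Y').obj, (G.objPreimage Y').property,
    ⟨(isCardinalPresentable D (Cardinal.lift.{t} κ)).ι.mapIso (G.objObjPreimageIso Y')⟩⟩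

/-- A morphism from a compact object to a `κ`-filtered colimit of compact objects factors through a
stage of the colimit, both in `C` and, since the extension preserves this colimit and compactness,
in `D`. Hence full faithfulness on compact objects propagates to all objects. -/
lemma full_and_faithful : i.Full ∧ i.Faithful := by
  have := hi.source
  have := hi.preserves
  refine full_and_faithful_of_presentations.{w} i (isCardinalPresentable C κ)
    (fun X Y hX hY ↦ hi.bijective_map_of_compact hX hY) (fun X ↦ ?_)
  obtain ⟨J, _, _, ⟨p⟩⟩ :=
    (isCardinalFilteredGenerator_isCardinalPresentable C κ).exists_colimitsOfShape X
  have := i.preservesColimitsOfShape_of_isCardinalAccessible κ J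
  refine ⟨J, inferInstance, isFiltered_of_isCardinalFiltered J κ, p, inferInstance,
    fun Z hZ ↦ ⟨?_, ?_⟩⟩
  · rw [isCardinalPresentable_iff] at hZ
    have := preservesColimitsOfShape_of_isCardinalPresentable Z κ J
    infer_instance
  · have h : IsCardinalPresentable (i.obj Z) (Cardinal.lift.{t} κ) := hi.map_compact Z hZ
    have := isCardinalFiltered_lift.{w, t} κ J
    have : EssentiallySmall.{max w t} J := essentiallySmallSelf J
    have := preservesColimitsOfShape_of_isCardinalPresentable_of_essentiallySmall (i.obj Z)
      (Cardinal.lift.{t} κ) J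
    infer_instance

/-- The extension preserves the `κ`-small colimits of compact objects: any object `X` of `D` is the
colimit of the `κ`-filtered diagram of all compact objects over `X`, and a `κ`-small family
of morphisms to `X`, or of equalities between such morphisms, is realized at a stage of this
diagram, which comes from `C`. -/
lemma isColimit_mapCocone_of_compact {J : Type u₃} [Category.{v₃} J]
    (hJ : HasCardinalLT (Arrow J) κ) {M : J ⥤ C} (hM : ∀ j, isCardinalPresentable C κ (M.obj j))
    {c : Cocone M} (hc : IsColimit c) (hpt : isCardinalPresentable C κ c.pt) :
    Nonempty (IsColimit (i.mapCocone c)) := by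
  have := hi.target
  obtain ⟨_, _⟩ := hi.full_and_faithful
  let K := isCardinalPresentable D (Cardinal.lift.{t} κ)
  have hJ' : HasCardinalLT (Arrow J) (Cardinal.lift.{t} κ) := by simpa using hJ
  -- The components of a cocone are compact objects over its point; a common upper bound of them in
  -- the filtered category of compact objects over this point comes from `C`.
  have existence (s : Cocone (M ⋙ i)) :
      ∃ f : i.obj c.pt ⟶ s.pt, ∀ j, i.map (c.ι.app j) ≫ f = s.ι.app j := by
    let F : J ⥤ CostructuredArrow K.ι s.pt :=
      { obj := fun j ↦ CostructuredArrow.mk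
          (Y := (⟨i.obj (M.obj j), hi.map_compact _ (hM j)⟩ : K.FullSubcategory)) (s.ι.app j)
        map := fun u ↦ CostructuredArrow.homMk (ObjectProperty.homMk (i.map (M.map u))) (s.w u)
        map_id := fun j ↦ by ext; simp
        map_comp := fun u v ↦ by ext; simp }
    let d := IsCardinalFiltered.cocone F hJ'
    obtain ⟨B, -, ⟨e⟩⟩ := hi.exists_iso_of_compact d.pt.left.property
    let S : Cocone M :=
      { pt := B
        ι :=
          { app := fun j ↦ i.preimage ((d.ι.app j).left.hom ≫ e.inv)
            naturality := fun j j' u ↦ i.map_injective (by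
              have h : i.map (M.map u) ≫ (d.ι.app j').left.hom = (d.ι.app j).left.hom :=
                congrArg (fun φ ↦ φ.left.hom) (d.w u)
              simp [reassoc_of% h]) } }
    refine ⟨i.map (hc.desc S) ≫ e.hom ≫ d.pt.hom, fun j ↦ ?_⟩
    have h₁ : (d.ι.app j).left.hom ≫ d.pt.hom = s.ι.app j := CostructuredArrow.w (d.ι.app j)
    rw [← i.map_comp_assoc, hc.fac, ← h₁]
    simp [S]
  -- Two morphisms out of the compact object `i.obj c.pt` which agree on the diagram already agree
  -- on it after they are factored through a common compact object over `X`.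
  have uniqueness {X : D} (f g : i.obj c.pt ⟶ X)
      (hfg : ∀ j, i.map (c.ι.app j) ≫ f = i.map (c.ι.app j) ≫ g) : f = g := by
    have := isFiltered_of_isCardinalFiltered (CostructuredArrow K.ι X) (Cardinal.lift.{t} κ)
    let pt : K.FullSubcategory := ⟨i.obj c.pt, hi.map_compact _ hpt⟩
    let a : CostructuredArrow K.ι X := CostructuredArrow.mk (Y := pt) f
    let b : CostructuredArrow K.ι X := CostructuredArrow.mk (Y := pt) g
    let x (j : J) : CostructuredArrow K.ι X := CostructuredArrow.mk
      (Y := (⟨i.obj (M.obj j), hi.map_compact _ (hM j)⟩ : K.FullSubcategory))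
      (i.map (c.ι.app j) ≫ f)
    let xa (j : J) : x j ⟶ a :=
      CostructuredArrow.homMk (ObjectProperty.homMk (i.map (c.ι.app j))) rfl
    let xb (j : J) : x j ⟶ b :=
      CostructuredArrow.homMk (ObjectProperty.homMk (i.map (c.ι.app j))) (hfg j).symm
    obtain ⟨l, α, hα⟩ := IsCardinalFiltered.multicoequalizer
      (fun j ↦ xa j ≫ IsFiltered.leftToMax a b) (fun j ↦ xb j ≫ IsFiltered.rightToMax a b)
      (hasCardinalLT_of_hasCardinalLT_arrow hJ')
    obtain ⟨B, -, ⟨e⟩⟩ := hi.exists_iso_of_compact l.left.property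
    let u : i.obj c.pt ⟶ l.left.obj := (IsFiltered.leftToMax a b ≫ α).left.hom
    let v : i.obj c.pt ⟶ l.left.obj := (IsFiltered.rightToMax a b ≫ α).left.hom
    have huv (j : J) : i.map (c.ι.app j) ≫ u = i.map (c.ι.app j) ≫ v := by
      have h := hα j
      simp only [Category.assoc] at h
      exact congrArg (fun φ ↦ φ.left.hom) h
    have huv' : i.preimage (u ≫ e.inv) = i.preimage (v ≫ e.inv) :=
      hc.hom_ext fun j ↦ i.map_injective (by simp [reassoc_of% (huv j)])
    have huv'' : u = v := by
      simpa [cancel_mono] using congrArg i.map huv'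
    have hu : u ≫ l.hom = f := CostructuredArrow.w (IsFiltered.leftToMax a b ≫ α)
    have hv : v ≫ l.hom = g := CostructuredArrow.w (IsFiltered.rightToMax a b ≫ α)
    rw [← hu, ← hv, huv'']
  exact ⟨{ desc := fun s ↦ (existence s).choose
           fac := fun s ↦ (existence s).choose_spec
           uniq := fun s m hm ↦ uniqueness _ _ fun j ↦
            (hm j).trans ((existence s).choose_spec j).symm }⟩

/-- A `κ`-small diagram of compact objects of the target comes from `C`, where it has a compact
colimit. -/
lemma hasColimit_of_cardinalLT_of_compact (hC : IsCardinalLocallyPresentable C κ)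
    {J : Type u₃} [Category.{v₃} J]
    (hJ : HasCardinalLT (Arrow J) κ) (M : J ⥤ D)
    (hM : ∀ j, isCardinalPresentable D (Cardinal.lift.{t} κ) (M.obj j)) : HasColimit M := by
  obtain ⟨_, _⟩ := hi.full_and_faithful
  have := hJ.small
  have := essentiallySmall_of_small_arrow.{w} J
  have := hasColimitsOfShape_of_hasColimitsOfSize (C := C) J
  have := small_of_small_arrow.{w} J
  have := isClosedUnderColimitsOfShape_isCardinalPresentable C (κ := κ) hJ
  obtain ⟨M', hM', ⟨iso⟩⟩ := exists_comp_iso i _ M (fun j ↦ hi.exists_iso_of_compact (hM j))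
  obtain ⟨h⟩ := hi.isColimit_mapCocone_of_compact hJ hM' (colimit.isColimit M')
    (ObjectProperty.prop_colimit _ _ hM')
  have : HasColimit (M' ⋙ i) := ⟨⟨_, h⟩⟩
  exact hasColimit_of_iso iso.symm

end IsAccessibleExtension

/-! ### Accessible extensions of locally presentable categories are cocontinuous -/

lemma partialIndex_multispan_obj_mem {C : Type u₁} [Category.{v₁} C] {E : Type u₃} [Category.{v₃} E]
    {G : E ⥤ C} {P : ObjectProperty C} (hG : ∀ e, P (G.obj e)) (Z : Set (E ⊕ Arrow E))
    (j : WalkingMultispan (partialShape Z)) : P ((partialIndex G Z).multispan.obj j) := by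
  cases j <;> exact hG _

namespace IsAccessibleExtension

variable {C : Type u₁} [Category.{v₁} C] {D : Type u₂} [Category.{v₂} D]
  {κ : Cardinal.{w}} [Fact κ.IsRegular] {i : C ⥤ D} (hi : IsAccessibleExtension.{w, t} κ i)
  (hC : IsCardinalLocallyPresentable C κ)

include hi hC

/-- The `κ`-filtered colimit of the colimits over the `κ`-small subgraphs of the index category is
preserved, and so are these partial colimits. -/
lemma preservesColimit_of_compact {E : Type w} [SmallCategory E] (G : E ⥤ C)
    (hG : ∀ e, isCardinalPresentable C κ (G.obj e)) : PreservesColimit G i := by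
  have := hi.preserves
  have hκ : Cardinal.aleph0 ≤ κ := Cardinal.IsRegular.aleph0_le Fact.out
  let M (Z : HasCardinalLT.Set (E ⊕ Arrow E) κ) := (partialIndex G Z.1).multispan
  have hM (Z) : IsColimit (colimit.cocone (M Z)) := colimit.isColimit (M Z)
  let x (Z : HasCardinalLT.Set (E ⊕ Arrow E) κ) (e : E) (he : Sum.inl e ∈ Z.1) :
    G.obj e ⟶ colimit (M Z) := colimit.ι (M Z) (WalkingMultispan.right ⟨e, he⟩)
  have hx (Z) : IsPartialColimit G Z.1 (x Z) :=
    isPartialColimit_map (𝟭 C) (c := colimit.cocone (M Z)) (isColimitOfPreserves (𝟭 C) (hM Z))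
  have hix (Z) : IsPartialColimit (G ⋙ i) Z.1 (fun e he ↦ i.map (x Z e he)) := by
    have hZ := hasCardinalLT_arrow_partialShape hκ Z.2
    have := isClosedUnderColimitsOfShape_isCardinalPresentable C (κ := κ) hZ
    have hMZ := partialIndex_multispan_obj_mem hG Z.1
    exact isPartialColimit_map i
      (hi.isColimit_mapCocone_of_compact hZ hMZ (hM Z) (ObjectProperty.prop_colimit _ _ hMZ)).some
  let Q := partialFunctor hx
  have hQ := colimit.isColimit Q
  have := i.preservesColimitsOfShape_of_isCardinalAccessible κ (HasCardinalLT.Set (E ⊕ Arrow E) κ)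
  obtain ⟨φ, ⟨hφ⟩, hφ'⟩ := exists_isColimit_of_isPartialColimit (Q := Q) hx
    (fun _ _ u e he ↦ partialFunctor_map hx u e he) hQ
  obtain ⟨ψ, ⟨hψ⟩, hψ'⟩ := exists_isColimit_of_isPartialColimit (Q := Q ⋙ i) hix
    (fun _ _ u e he ↦ (i.map_comp _ _).symm.trans (congrArg i.map (partialFunctor_map hx u e he)))
    (isColimitOfPreserves i hQ)
  refine preservesColimit_of_preserves_colimit_cocone hφ
    (hψ.ofIsoColimit (Cocone.ext (Iso.refl _) (fun e ↦ ?_)))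
  let Z : HasCardinalLT.Set (E ⊕ Arrow E) κ := ⟨{Sum.inl e}, hasCardinalLT_of_finite _ _ hκ⟩
  exact (Category.comp_id _).trans ((hψ' Z e rfl).trans
    ((i.map_comp _ _).symm.trans (congrArg i.map (hφ' Z e rfl).symm)))

/-- The extension preserves all small colimits: those of compact objects are `κ`-filtered colimits
of `κ`-small colimits of compact objects, and all the others reduce to these by density. -/
lemma preservesColimitsOfSize : PreservesColimitsOfSize.{w, w} i where
  preservesColimitsOfShape {J _} := ⟨fun {F} ↦ by
    have := hi.preserves
    let K := (isCardinalPresentable C κ).ι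
    have := essentiallySmall_comma K F
    let e := equivSmallModel.{w} (Comma K F)
    have := hasColimitsOfShape_of_hasColimitsOfSize (C := C) (Comma K F)
    have : PreservesColimit (Comma.fst K F ⋙ K ⋙ 𝟭 C) i := by
      change PreservesColimit (Comma.fst K F ⋙ K) i
      have : PreservesColimit (e.symm.functor ⋙ Comma.fst K F ⋙ K) i :=
        hi.preservesColimit_of_compact hC (e.inverse ⋙ Comma.fst K F ⋙ K)
        (fun f ↦ ((Comma.fst K F).obj (e.inverse.obj f)).property)
      let hc := colimit.isColimit (Comma.fst K F ⋙ K)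
      let h := isColimitOfPreserves i (hc.whiskerEquivalence e.symm)
      exact preservesColimit_of_preserves_colimit_cocone hc
        (IsColimit.ofWhiskerEquivalence e.symm h)
    have h₁ := fun j ↦ isColimit_mapCocone_canonicalCocone κ (𝟭 C) (F.obj j)
    have h₂ := fun j ↦ isColimit_mapCocone_canonicalCocone κ i (F.obj j)
    let s : Cocone (Comma.fst K F ⋙ K ⋙ 𝟭 C) := colimit.cocone (Comma.fst K F ⋙ K)
    have hs : IsColimit s := colimit.isColimit (Comma.fst K F ⋙ K)
    obtain ⟨c, hc, ⟨hc'⟩⟩ := exists_isColimit_of_comma h₁ hs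
    rw [← hc] at hs
    let c₀ : Cocone F := c
    let hc₀ : IsColimit c₀ := hc'
    have hs₀ : IsColimit (i.mapCocone (commaCocone (K := K) c :
      Cocone (Comma.fst K F ⋙ K))) := isColimitOfPreserves i hs
    exact preservesColimit_of_preserves_colimit_cocone hc₀
      (isColimitOfCommaCocone (K := K) h₂ (i.mapCocone c₀)
        (hs₀.ofIsoColimit (Cocone.ext (Iso.refl _)
          (fun f ↦ (Category.comp_id _).trans (i.map_comp _ _)))))⟩

/-- The colimit is the `κ`-filtered colimit of the colimits over the `κ`-small subgraphs. -/
lemma hasColimit_of_small_of_compact {E : Type max w t} [SmallCategory E] (G : E ⥤ D)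
    (hG : ∀ e, isCardinalPresentable D (Cardinal.lift.{t} κ) (G.obj e)) : HasColimit G := by
  have := hi.target
  let κ' := Cardinal.lift.{t} κ
  have hκ : Cardinal.aleph0 ≤ κ := Cardinal.IsRegular.aleph0_le Fact.out
  let M (Z : HasCardinalLT.Set (E ⊕ Arrow E) κ') := (partialIndex G Z.1).multispan
  have (Z : HasCardinalLT.Set (E ⊕ Arrow E) κ') : HasColimit (M Z) := by
    have hZ : HasCardinalLT Z.1 κ := by simpa [κ'] using Z.2
    exact hi.hasColimit_of_cardinalLT_of_compact hC (hasCardinalLT_arrow_partialShape hκ hZ) _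
      (partialIndex_multispan_obj_mem hG Z.1)
  let x (Z : HasCardinalLT.Set (E ⊕ Arrow E) κ') (e : E) (he : Sum.inl e ∈ Z.1) :
    G.obj e ⟶ colimit (M Z) := colimit.ι (M Z) (WalkingMultispan.right ⟨e, he⟩)
  have hx (Z) : IsPartialColimit G Z.1 (x Z) :=
    isPartialColimit_map (𝟭 D) (c := colimit.cocone (M Z))
      (isColimitOfPreserves (𝟭 D) (colimit.isColimit (M Z)))
  have := HasCardinalFilteredColimits.hasColimitsOfShape D κ'
    (HasCardinalLT.Set (E ⊕ Arrow E) κ')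
  obtain ⟨φ, ⟨hφ⟩, -⟩ := exists_isColimit_of_isPartialColimit (Q := partialFunctor hx) hx
    (fun _ _ u e he ↦ partialFunctor_map hx u e he) (colimit.isColimit _)
  exact ⟨⟨_, hφ⟩⟩

/-- The target of the extension is cocomplete, for the same reason as the extension is
cocontinuous. -/
lemma hasColimitsOfSize : HasColimitsOfSize.{max w t, max w t} D where
  has_colimits_of_shape J _ := ⟨fun F ↦ by
    have := hi.target
    let K := (isCardinalPresentable D (Cardinal.lift.{t} κ)).ι
    have := essentiallySmall_comma K F
    let e := equivSmallModel.{max w t} (Comma K F)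
    have : HasColimit (e.symm.functor ⋙ Comma.fst K F ⋙ K) :=
      hi.hasColimit_of_small_of_compact hC _
        (fun f ↦ ((Comma.fst K F).obj (e.inverse.obj f)).property)
    have : HasColimit (Comma.fst K F ⋙ K) := hasColimit_of_equivalence_comp e.symm
    have h := fun j ↦
      isColimit_mapCocone_canonicalCocone (Cardinal.lift.{t} κ) (𝟭 D) (F.obj j)
    let s : Cocone (Comma.fst K F ⋙ K ⋙ 𝟭 D) := colimit.cocone (Comma.fst K F ⋙ K)
    have hs : IsColimit s := colimit.isColimit (Comma.fst K F ⋙ K)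
    obtain ⟨c, -, ⟨hc⟩⟩ := exists_isColimit_of_comma h hs
    exact ⟨⟨(c : Cocone F), hc⟩⟩⟩

lemma isCardinalLocallyPresentable_target :
    IsCardinalLocallyPresentable D (Cardinal.lift.{t} κ) :=
  have := hi.target
  have := hi.hasColimitsOfSize hC
  { }

end IsAccessibleExtension

/-! ### Compact objects of higher index -/

namespace IsAccessibleExtension

variable {C : Type u₁} [Category.{v₁} C] {D : Type u₂} [Category.{v₂} D]
  {κ : Cardinal.{w}} [Fact κ.IsRegular] {i : C ⥤ D} (hi : IsAccessibleExtension.{w, t} κ i)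
  (hC : IsCardinalLocallyPresentable C κ)

include hi

/-- Compactness is reflected, because `i` is fully faithful and preserves filtered colimits. -/
lemma isCardinalPresentable_of_map (l : Cardinal.{w}) [Fact l.IsRegular] (hl : κ ≤ l) (X : C)
    (hX : isCardinalPresentable D (Cardinal.lift.{t} l) (i.obj X)) :
    isCardinalPresentable C l X := by
  obtain ⟨_, _⟩ := hi.full_and_faithful
  have := hi.preserves
  have := i.isCardinalAccessible_of_le hl
  rw [isCardinalPresentable_iff] at hX ⊢
  have : (coyoneda.obj (op (i.obj X))).IsCardinalAccessible l :=
    { preservesColimitOfShape := fun J _ _ ↦ by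
        have := isCardinalFiltered_lift.{w, t} l J
        have : EssentiallySmall.{max w t} J := essentiallySmallSelf J
        exact preservesColimitsOfShape_of_isCardinalPresentable_of_essentiallySmall (i.obj X)
          (Cardinal.lift.{t} l) J }
  rw [isCardinalPresentable_iff_isCardinalAccessible_uliftCoyoneda_obj.{v₂}]
  let e : i ⋙ coyoneda.obj (op (i.obj X)) ⋙ uliftFunctor.{v₁} ≅ uliftCoyoneda.{v₂}.obj (op X) :=
    NatIso.ofComponents (fun Y ↦ Equiv.toIso
      ((Equiv.ulift.trans (Functor.FullyFaithful.ofFullyFaithful i).homEquiv.symm).trans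
        Equiv.ulift.symm)) (fun {Y Z} f ↦ by
          ext ⟨g⟩
          obtain ⟨g, rfl⟩ := i.map_surjective g
          refine ULift.down_injective (i.map_injective ?_)
          exact (i.map_preimage _).trans
            (((i.map_comp _ _).trans (congrArg (· ≫ i.map f) (i.map_preimage _))).symm))
  exact Functor.isCardinalAccessible_of_natIso e l

include hC

/-- Since the compact objects of index `l` are generated by those of index `κ` under `l`-small
colimits, which the extension preserves, compactness of index `l` is preserved too. -/
lemma map_isCardinalPresentable (l : Cardinal.{w}) [Fact l.IsRegular] (hl : κ ≤ l) (X : C)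
    (hX : isCardinalPresentable C l X) :
    isCardinalPresentable D (Cardinal.lift.{t} l) (i.obj X) := by
  have := hi.target
  have := hi.preservesColimitsOfSize hC
  obtain ⟨P, _, hP, hP'⟩ :=
    (IsCardinalLocallyPresentable.iff_exists_isStrongGenerator C κ).1 inferInstance
  rw [IsStrongGenerator.colimitsCardinalClosure_eq_isCardinalPresentable hP
    (hP'.trans (isCardinalPresentable_monotone C hl))] at hX
  refine P.colimitsCardinalClosure_le l
    (Q := (isCardinalPresentable D (Cardinal.lift.{t} l)).inverseImage i)
    (fun J _ hJ ↦ ?_) (fun Y hY ↦ ?_) X hX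
  · have := isClosedUnderColimitsOfShape_isCardinalPresentable D
      (κ := Cardinal.lift.{t} l) (J := J) (by simpa using hJ)
    infer_instance
  · exact isCardinalPresentable_monotone D (Cardinal.lift_le.2 hl) _ (hi.map_compact Y (hP' Y hY))

/-- A small diagram in the essential image lifts to `C`, where it has a colimit, which `i`
preserves. -/
lemma isClosedUnderColimitsOfShape_essImage (J : Type u₃) [Category.{v₃} J]
    [EssentiallySmall.{w} J] : i.essImage.IsClosedUnderColimitsOfShape J where
  colimitsOfShape_le := by
    rintro Y ⟨p⟩
    obtain ⟨_, _⟩ := hi.full_and_faithful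
    have := hi.preservesColimitsOfSize hC
    have : PreservesColimitsOfShape J i :=
      preservesColimitsOfShape_of_equiv (equivSmallModel.{w} J).symm i
    have := hasColimitsOfShape_of_hasColimitsOfSize (C := C) J
    obtain ⟨F, -, ⟨e⟩⟩ := exists_comp_iso i ⊤ p.diag
      (fun j ↦ (p.prop_diag_obj j).imp fun _ h ↦ ⟨trivial, h⟩)
    exact ⟨colimit F, ⟨(isColimitOfPreserves i (colimit.isColimit F)).coconePointsIsoOfNatIso
      p.isColimit e⟩⟩

/-- The compact objects of `D` of an index `l` in `U⁺` such that `l`-small categories are `U`-small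
are `U`-small colimits of compact objects of index `κ`, and so they come from `C`. -/
lemma isCardinalPresentable_le_essImage (l : Cardinal.{max w t}) [Fact l.IsRegular]
    (hl : Cardinal.lift.{t} κ ≤ l)
    (h : ∀ (J : Type max w t) [SmallCategory J], HasCardinalLT (Arrow J) l →
      EssentiallySmall.{w} J) :
    isCardinalPresentable D l ≤ i.essImage := by
  have := hi.isCardinalLocallyPresentable_target hC
  obtain ⟨P, _, hP, hP'⟩ := (IsCardinalLocallyPresentable.iff_exists_isStrongGenerator D
    (Cardinal.lift.{t} κ)).1 inferInstance
  rw [IsStrongGenerator.colimitsCardinalClosure_eq_isCardinalPresentable hP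
    (hP'.trans (isCardinalPresentable_monotone D hl))]
  refine P.colimitsCardinalClosure_le l (fun J _ hJ ↦ ?_) (fun Y hY ↦ ?_)
  · have := h J hJ
    exact hi.isClosedUnderColimitsOfShape_essImage hC J
  · exact (hi.exists_iso_of_compact (hP' Y hY)).imp fun _ h ↦ h.2

/-- The compact objects of `D` of index `l` come from objects of `C`, which are compact of index `l`
since compactness is reflected. -/
lemma of_le (l : Cardinal.{w}) [Fact l.IsRegular] (hl : κ ≤ l) :
    IsAccessibleExtension.{w, t} l i := by
  have := hi.preserves
  have := hi.isCardinalLocallyPresentable_target hC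
  have := IsCardinalLocallyPresentable.of_le C hl
  have hl' : Cardinal.lift.{t} κ ≤ Cardinal.lift.{t} l := Cardinal.lift_le.2 hl
  have := IsCardinalLocallyPresentable.of_le D hl'
  obtain ⟨_, _⟩ := hi.full_and_faithful
  have hmap := hi.map_isCardinalPresentable hC l hl
  refine
    { source := inferInstance
      preserves := i.isCardinalAccessible_of_le hl
      target := inferInstance
      map_compact := hmap
      isEquivalence_compact := ?_ }
  have : ((isCardinalPresentable D (Cardinal.lift.{t} l)).lift
      ((isCardinalPresentable C l).ι ⋙ i) (fun X ↦ hmap X.obj X.property)).EssSurj := ⟨fun Y ↦ by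
    obtain ⟨X, ⟨e⟩⟩ := hi.isCardinalPresentable_le_essImage hC _ hl' (fun J _ hJ ↦ by
      have hJ' : HasCardinalLT (Arrow J) l := by simpa using hJ
      have := hJ'.small
      exact essentiallySmall_of_small_arrow.{w} J) Y.obj Y.property
    have hX := (isCardinalPresentable D (Cardinal.lift.{t} l)).prop_of_iso e.symm Y.property
    exact ⟨⟨X, hi.isCardinalPresentable_of_map l hl X hX⟩, ⟨ObjectProperty.isoMk _ e⟩⟩⟩
  exact { }

section

variable {m : Cardinal.{max w t}} [Fact m.IsRegular]
  (hm : Cardinal.lift.{w + 1} m = Cardinal.univ.{w, t})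

include hm

/-- Every object of `C` is the colimit of a `U`-small diagram of compact objects, and `U`-small
categories are `m`-small when `m` is the cardinality of `U`. -/
lemma isCardinalPresentable_obj_of_lift_eq_univ (X : C) : isCardinalPresentable D m (i.obj X) := by
  have := hi.target
  have := hi.preservesColimitsOfSize hC
  obtain ⟨J, _, _, ⟨p⟩⟩ :=
    (isCardinalFilteredGenerator_isCardinalPresentable C κ).exists_colimitsOfShape X
  have (j : J) : IsCardinalPresentable ((p.diag ⋙ i).obj j) m :=
    isCardinalPresentable_monotone D (lift_le_of_lift_eq_univ hm κ) _
      (hi.map_compact _ (p.prop_diag_obj j))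
  exact isCardinalPresentable_of_isColimit _ (isColimitOfPreserves i p.isColimit) m
    ((hasCardinalLT_iff_small_of_lift_eq_univ hm _).2 (small_self _))

lemma isCardinalPresentable_le_essImage_of_lift_eq_univ :
    isCardinalPresentable D m ≤ i.essImage :=
  hi.isCardinalPresentable_le_essImage hC m (lift_le_of_lift_eq_univ hm κ) (fun J _ hJ ↦ by
    have := (hasCardinalLT_iff_small_of_lift_eq_univ hm _).1 hJ
    exact essentiallySmall_of_small_arrow.{w} J)

end

end IsAccessibleExtension

/-! ### Ind-completions -/

section Ind

variable {C : Type u₁} [Category.{v₁} C] {D : Type u₂} [Category.{v₂} D]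
  {m : Cardinal.{w}} [Fact m.IsRegular] {i : C ⥤ D}

/-- Every ind-object is, in the ind-completion, a filtered colimit of objects of `C`. -/
lemma exists_colimitOfShape_indCompletion (X : IndCompletion C m) :
    ∃ (J : Type w) (_ : SmallCategory J) (_ : IsCardinalFiltered J m),
      Nonempty ((ObjectProperty.ofObj (indEmbedding C m).obj).ColimitOfShape J X) := by
  obtain ⟨J, _, hJ, F, ι, ⟨h⟩⟩ := X.property
  let c : Cocone (F ⋙ indEmbedding C m) :=
    { pt := X
      ι :=
        { app := fun j ↦ ObjectProperty.homMk (ι.app j)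
          naturality := fun j j' u ↦ by
            ext1
            exact ι.naturality u } }
  have hc : IsColimit ((isIndObject C m).ι.mapCocone c) := h
  exact ⟨J, inferInstance, hJ, ⟨
    { diag := F ⋙ indEmbedding C m
      ι := c.ι
      isColimit := isColimitOfReflects (isIndObject C m).ι hc
      prop_diag_obj := fun j ↦ ⟨F.obj j⟩ }⟩⟩

instance : (indEmbedding C m).Full := by
  unfold indEmbedding; infer_instance

instance : (indEmbedding C m).Faithful := by
  unfold indEmbedding; infer_instance

/-- Colimits of presheaves are computed objectwise, and each `i.obj X` is compact. -/
lemma preservesColimitsOfShape_restrictedULiftYoneda {D : Type u₂} [Category.{w} D] (i : C ⥤ D)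
    (h : ∀ X, isCardinalPresentable D m (i.obj X)) (J : Type w) [SmallCategory J]
    [IsCardinalFiltered J m] :
    PreservesColimitsOfShape J (Presheaf.restrictedULiftYoneda.{max w v₁} i) := by
  refine preservesColimitsOfShape_of_evaluation _ _ fun A ↦ ?_
  have hA : IsCardinalPresentable (i.obj A.unop) m := h A.unop
  have := preservesColimitsOfShape_of_isCardinalPresentable (i.obj A.unop) m J
  have : PreservesColimitsOfShape J
    (coyoneda.obj (op (i.obj A.unop)) ⋙ uliftFunctor.{max w v₁}) := inferInstance
  exact this

/-- The restricted Yoneda functor of a fully faithful functor `i` extends the Yoneda embedding. -/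
noncomputable def compRestrictedULiftYonedaIso {D : Type u₂} [Category.{w} D] (i : C ⥤ D)
    [i.Full] [i.Faithful] :
    i ⋙ Presheaf.restrictedULiftYoneda.{max w v₁} i ≅ uliftYoneda.{w} :=
  NatIso.ofComponents (fun A ↦ NatIso.ofComponents (fun B ↦ Equiv.toIso
      ((Equiv.ulift.trans (Functor.FullyFaithful.ofFullyFaithful i).homEquiv.symm).trans
        Equiv.ulift.symm)) (fun {B B'} f ↦ by
          ext ⟨g⟩
          obtain ⟨g, rfl⟩ := i.map_surjective g
          refine ULift.down_injective (i.map_injective ?_)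
          exact (i.map_preimage _).trans
            (((i.map_comp _ _).trans (congrArg (i.map f.unop ≫ ·) (i.map_preimage _))).symm)))
    (fun {A A'} f ↦ by
      ext B ⟨g⟩
      obtain ⟨g, rfl⟩ := i.map_surjective g
      refine ULift.down_injective (i.map_injective ?_)
      exact (i.map_preimage _).trans
        (((i.map_comp _ _).trans (congrArg (· ≫ i.map f) (i.map_preimage _))).symm))

variable [i.Full] [i.Faithful]
  (h : ∀ X, isCardinalPresentable D m (i.obj X)) (h' : isCardinalPresentable D m ≤ i.essImage)

include h' in
lemma isEquivalence_lift : ((isCardinalPresentable D m).lift i h).IsEquivalence := by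
  have : ((isCardinalPresentable D m).lift i h).EssSurj := ⟨fun Y ↦ by
    obtain ⟨X, ⟨e⟩⟩ := h' _ Y.property
    exact ⟨X, ⟨ObjectProperty.isoMk _ e⟩⟩⟩
  exact { }

variable [IsCardinalAccessibleCategory D m]

include h' in
lemma exists_isColimit_comp (X : D) :
    ∃ (J : Type w) (_ : SmallCategory J) (_ : IsCardinalFiltered J m) (F : J ⥤ C)
      (c : Cocone (F ⋙ i)) (_ : IsColimit c), Nonempty (c.pt ≅ X) := by
  obtain ⟨J, _, hJ, ⟨p⟩⟩ :=
    (isCardinalFilteredGenerator_isCardinalPresentable D m).exists_colimitsOfShape X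
  obtain ⟨F, -, ⟨e⟩⟩ := exists_comp_iso i ⊤ p.diag
    (fun j ↦ (h' _ (p.prop_diag_obj j)).imp fun _ h ↦ ⟨trivial, h⟩)
  exact ⟨J, inferInstance, hJ, F, (Cocone.precompose e.hom).obj p.cocone,
    (IsColimit.precomposeHomEquiv e _).2 p.isColimit, ⟨Iso.refl _⟩⟩

include h h' in
lemma isDense_of_essImage : i.IsDense := by
  have := isEquivalence_lift h h'
  exact inferInstanceAs
    ((isCardinalPresentable D m).lift i h ⋙ (isCardinalPresentable D m).ι).IsDense

/-- The case of `exists_equivalence_indCompletion` where the morphisms of `D` are in `Type w`, so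
that the restricted Yoneda functor, which is the equivalence, is available without shrinking. -/
lemma exists_equivalence_indCompletion_aux {D : Type u₂} [Category.{w} D] (i : C ⥤ D)
    [IsCardinalAccessibleCategory D m] [i.Full] [i.Faithful]
    (h : ∀ X, isCardinalPresentable D m (i.obj X))
    (h' : isCardinalPresentable D m ≤ i.essImage) :
    ∃ E : D ⥤ IndCompletion C m, E.IsEquivalence ∧ Nonempty (i ⋙ E ≅ indEmbedding C m) := by
  let R : D ⥤ Cᵒᵖ ⥤ Type max w v₁ := Presheaf.restrictedULiftYoneda.{max w v₁} i
  let iso : i ⋙ R ≅ uliftYoneda.{w} := compRestrictedULiftYonedaIso i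
  have := isDense_of_essImage h h'
  have : R.Full := inferInstanceAs (Presheaf.restrictedULiftYoneda.{max w v₁} i).Full
  have : R.Faithful := inferInstanceAs (Presheaf.restrictedULiftYoneda.{max w v₁} i).Faithful
  have hR (J : Type w) [SmallCategory J] [IsCardinalFiltered J m] : PreservesColimitsOfShape J R :=
    preservesColimitsOfShape_restrictedULiftYoneda i h J
  have key {J : Type w} [SmallCategory J] [IsCardinalFiltered J m] {F : J ⥤ C}
      {c : Cocone (F ⋙ i)} (hc : IsColimit c) : Nonempty (IsColimit
        ((Cocone.precompose (Functor.isoWhiskerLeft F iso).inv).obj (R.mapCocone c))) :=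
    ⟨(IsColimit.precomposeInvEquiv (Functor.isoWhiskerLeft F iso) _).2 (isColimitOfPreserves R hc)⟩
  have mem (X : D) : isIndObject C m (R.obj X) := by
    obtain ⟨J, _, hJ, F, c, hc, ⟨e⟩⟩ := exists_isColimit_comp (m := m) h' X
    obtain ⟨hc'⟩ := key hc
    exact ⟨J, inferInstance, hJ, F, _,
      ⟨hc'.ofIsoColimit (Cocone.extendIso _ (R.mapIso e))⟩⟩
  have : ((isIndObject C m).lift R mem).EssSurj := ⟨fun P ↦ by
    obtain ⟨J, _, hJ, F, φ, ⟨hφ⟩⟩ := P.property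
    have := HasCardinalFilteredColimits.hasColimitsOfShape D m J
    obtain ⟨hc⟩ := key (colimit.isColimit (F ⋙ i))
    exact ⟨colimit (F ⋙ i), ⟨ObjectProperty.isoMk _ (hc.coconePointUniqueUpToIso hφ)⟩⟩⟩
  exact ⟨(isIndObject C m).lift R mem, { },
    ⟨NatIso.ofComponents (fun A ↦ ObjectProperty.isoMk _ (iso.app A)) (fun f ↦ by
      ext1
      exact iso.hom.naturality f)⟩⟩

include h h' in
/-- A category `D` which is accessible of index `m` is the ind-completion of its full subcategory of
compact objects. -/
lemma exists_equivalence_indCompletion :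
    ∃ E : D ⥤ IndCompletion C m, E.IsEquivalence ∧ Nonempty (i ⋙ E ≅ indEmbedding C m) := by
  -- `D` is locally small, but its morphisms may lie in another universe than `w`.
  let e := ShrinkHoms.equivalence.{w} D
  have := e.isCardinalAccessibleCategory m
  obtain ⟨E, _, ⟨iso⟩⟩ := exists_equivalence_indCompletion_aux (m := m) (i ⋙ e.functor)
    (fun X ↦ by
      have : IsCardinalPresentable (i.obj X) m := h X
      exact isCardinalPresentable_of_isEquivalence (i.obj X) m e.functor)
    (fun Y hY ↦ by
      have : IsCardinalPresentable Y m := hY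
      obtain ⟨X, ⟨f⟩⟩ := h' (e.inverse.obj Y) (isCardinalPresentable_of_isEquivalence Y m e.inverse)
      exact ⟨X, ⟨e.functor.mapIso f ≪≫ e.counitIso.app Y⟩⟩)
  exact ⟨e.functor ⋙ E, inferInstance, ⟨(Functor.associator _ _ _).symm ≪≫ iso⟩⟩

include h h' in
/-- A quasi-inverse of the restricted Yoneda functor of `i` extends `i` to the ind-completion. -/
lemma exists_isIndExtension : ∃ G : IndCompletion C m ⥤ D, IsIndExtension m i G := by
  obtain ⟨E, _, ⟨iso⟩⟩ := exists_equivalence_indCompletion h h'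
  exact ⟨E.inv,
    { accessible :=
        { source := E.asEquivalence.isCardinalAccessibleCategory m
          preserves := inferInstance }
      restrict := ⟨Functor.isoWhiskerRight iso.symm E.inv ≪≫ Functor.associator _ _ _ ≪≫
        Functor.isoWhiskerLeft i E.asEquivalence.unitIso.symm ≪≫ i.rightUnitor⟩ }⟩

include h h' in
/-- Full faithfulness is checked on representables, which are compact in the ind-completion and are
sent to objects isomorphic to values of `i`, compact by assumption. -/
lemma isEquivalence_of_isIndExtension {G : IndCompletion C m ⥤ D} (hG : IsIndExtension m i G) :
    G.IsEquivalence := by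
  obtain ⟨E, _, ⟨iso⟩⟩ := exists_equivalence_indCompletion h h'
  obtain ⟨e⟩ := hG.restrict
  have := hG.accessible.source
  have := hG.accessible.preserves
  have : G.Full ∧ G.Faithful := by
    refine full_and_faithful_of_presentations.{w} G
      (ObjectProperty.ofObj (indEmbedding C m).obj) ?_ (fun X ↦ ?_)
    · rintro _ _ ⟨A⟩ ⟨B⟩
      have h₁ : Function.Bijective
          ((indEmbedding C m ⋙ G).map : (A ⟶ B) → _) := by
        have : (indEmbedding C m ⋙ G).Full := Functor.Full.of_iso e.symm
        have : (indEmbedding C m ⋙ G).Faithful := Functor.Faithful.of_iso e.symm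
        exact (Functor.FullyFaithful.ofFullyFaithful _).map_bijective A B
      have h₂ : Function.Bijective ((indEmbedding C m).map : (A ⟶ B) → _) :=
        (Functor.FullyFaithful.ofFullyFaithful _).map_bijective A B
      exact (Function.Bijective.of_comp_iff _ h₂).1 h₁
    · obtain ⟨J, _, _, ⟨p⟩⟩ := exists_colimitOfShape_indCompletion X
      have := G.preservesColimitsOfShape_of_isCardinalAccessible m J
      refine ⟨J, inferInstance, isFiltered_of_isCardinalFiltered J m, p, inferInstance, ?_⟩
      rintro _ ⟨A⟩
      have hA : IsCardinalPresentable (i.obj A) m := h A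
      have : IsCardinalPresentable ((i ⋙ E).obj A) m :=
        isCardinalPresentable_of_isEquivalence (i.obj A) m E
      have h₁ : IsCardinalPresentable ((indEmbedding C m).obj A) m :=
        isCardinalPresentable_of_iso (iso.app A) m
      have h₂ : IsCardinalPresentable (G.obj ((indEmbedding C m).obj A)) m :=
        isCardinalPresentable_of_iso (e.symm.app A) m
      have := preservesColimitsOfShape_of_isCardinalPresentable ((indEmbedding C m).obj A) m J
      have := preservesColimitsOfShape_of_isCardinalPresentable
        (G.obj ((indEmbedding C m).obj A)) m J
      exact ⟨inferInstance, inferInstance⟩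
  obtain ⟨_, _⟩ := this
  have : G.EssSurj := ⟨fun Y ↦ by
    obtain ⟨J, _, _, F, c, hc, ⟨f⟩⟩ := exists_isColimit_comp (m := m) h' Y
    have := HasCardinalFilteredColimits.hasColimitsOfShape (IndCompletion C m) m J
    have := G.preservesColimitsOfShape_of_isCardinalAccessible m J
    exact ⟨colimit (F ⋙ indEmbedding C m),
      ⟨(isColimitOfPreserves G (colimit.isColimit (F ⋙ indEmbedding C m))).coconePointsIsoOfNatIso
        hc (Functor.associator _ _ _ ≪≫ Functor.isoWhiskerLeft F e) ≪≫ f⟩⟩⟩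
  exact { }

end Ind

end UniverseEnlargement

theorem mainTheorem2
    {C : Type u₁} [Category.{v₁} C] {D : Type u₂} [Category.{v₂} D]
    (κ : Cardinal.{w}) [Fact κ.IsRegular] (i : C ⥤ D)
    (hi : UniverseEnlargement.IsAccessibleExtension.{w, t} κ i)
    (hC : IsCardinalLocallyPresentable C κ) :
    -- (i) stability under raising the index of accessibility
    (∀ (l : Cardinal.{w}) [Fact l.IsRegular], κ ≤ l →
      UniverseEnlargement.IsAccessibleExtension.{w, t} l i) ∧
    -- `m` is the cardinality of the smaller universe, as a cardinal in the larger universe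
    (∀ m : Cardinal.{max w t}, Cardinal.lift.{w + 1} m = Cardinal.univ.{w, t} →
      ∃ _ : Fact m.IsRegular,
        -- (ii) `i` is an equivalence onto the compact objects of index `m`
        (∃ h : ∀ X : C, isCardinalPresentable D m (i.obj X),
          ((isCardinalPresentable D m).lift i h).IsEquivalence) ∧
        -- (iii) the functor induced by `i` on the ind-completion exists and is an equivalence
        (∃ G : UniverseEnlargement.IndCompletion C m ⥤ D,
          UniverseEnlargement.IsIndExtension m i G) ∧
        (∀ G : UniverseEnlargement.IndCompletion C m ⥤ D,
          UniverseEnlargement.IsIndExtension m i G → G.IsEquivalence)) := by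
  refine ⟨fun l _ hl ↦ hi.of_le hC l hl, fun m hm ↦ ?_⟩
  have hm' : Fact m.IsRegular := ⟨UniverseEnlargement.isRegular_of_lift_eq_univ hm⟩
  have := hi.isCardinalLocallyPresentable_target hC
  have := IsCardinalLocallyPresentable.of_le D
    (UniverseEnlargement.lift_le_of_lift_eq_univ hm κ)
  obtain ⟨_, _⟩ := hi.full_and_faithful
  have h := hi.isCardinalPresentable_obj_of_lift_eq_univ hC hm
  have h' := hi.isCardinalPresentable_le_essImage_of_lift_eq_univ hC hm
  exact ⟨hm', ⟨h, UniverseEnlargement.isEquivalence_lift h h'⟩,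
    UniverseEnlargement.exists_isIndExtension h h',
    fun G hG ↦ UniverseEnlargement.isEquivalence_of_isIndExtension h h' hG⟩
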